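/- **Setting.** Fix positive integers $d_{\rm in},k,d,n,C,L$. A network with $L$ MLP blocks consists of sets $\mathcal S_0,\dots,\mathcal S_L$, an embedding $E:\mathbb R^{d_{\rm in}}\to\mathcal S_0$, and, with disjoint blocks of real parameters, maps $T^l:\mathcal S_{l-1}\to\mathbb R^{k\times d}$, $R^l:\mathbb R^{k\times d}\times\mathcal S_{l-1}\to\mathcal S_l$ ($l\in[L]$) and $D:\mathcal S_L\to\mathbb R^C$. On input $x$ it computes $S^0=E(x)$ and, for $l=1,\dots,L$, $$X^l=T^l(S^{l-1}),\quad P^l=X^l(K^l)^\top+\mathbf 1(b^{l,K})^\top,\quad A^l=\sigma(P^l),\quad Z^l=A^l(V^l)^\top+\mathbf 1(b^{l,V})^\top,\quad S^l=R^l(Z^l,S^{l-1}),$$ and $F(c\mid x,\theta)=\operatorname{softmax}(D(S^L))_c$; here $K^l\in\mathbb R^{n\times d}$, $V^l\in\mathbb R^{d\times n}$, $\sigma$ acts entrywise, and $\theta$ collects all parameters. Let $D^l\in\mathbb R^{k\times n}$ have entries $d^l_{ij}=\sigma'(p^l_{ij})$ if this derivative exists and $0$ otherwise; let $x^l_i$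 be the $i$-th row (token) of $X^l$, and let $\|\cdot\|_0$ count non-zero entries. The loss on $s=(x,y)$ is $\ell=-\log F(y\mid x,\theta)$, and $\partial\ell/\partial a^l_{ij}$ is its derivative in the entry $a^l_{ij}$ of the hidden feature $A^l$ (later layers being recomputed from $A^l$). The copied network $\tilde F$ has, for each $l$ and each token index $i\in[k]$, its own copies $T^{l,i}$ and $(K^{l,i},b^{l,i,K},V^{l,i},b^{l,i,V})$ of the parameters of $T^l$ and of the $l$-th MLP block; row $i$ of its $Z^l$ is the $i$-th MLP copy applied to row $i$ of $T^{l,i}(S^{l-1})$; everything else is as in $F$. The copied parameter $\tilde\theta$ of $\theta$ gives all copies the values they have in $\theta$. Let $\tilde\theta_K^l$ be the entries of $K^{l,1},\dots,K^{l,k}$. For a non-empty finite training set $\mathcal D\subset\mathbb R^{d_{\rm in}}\times[C]$, let $\hat{\mathcal L}$ be the mean loss over $\mathcal D$. The augmented flatness of $\tilde F$ with respect to $\tilde\theta_K^l$ is $$\widetilde{\mathrm{AF}}_l=\operatorname{tr}\Big(\nabla^2_{\tilde\theta_K^l}\hat{\mathcal L}(\tilde F_{\tilde\theta})+\mathbb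 E_{(x,y)\sim U(\mathcal D)}\Big[\tfrac{\nabla^2_{\tilde\theta_K^l}\tilde F(y\mid x,\tilde\theta)}{\tilde F(y\mid x,\tilde\theta)}\Big]\Big).$$ Call $\sigma:\mathbb R\to\mathbb R$ *jumping* if $\sigma(x)=0$ for $x\le0$ and $\sigma(x)>0$ for $x>0$; $\sigma$ is (continuous and) twice continuously differentiable on $(-\infty,0)$ and on $(0,\infty)$; and $|\sigma'(x)|\ge1$ for $x>0$, $\sigma'(x)=0$ for $x<0$. For instance $\mathrm{JSReLU}(x)=\frac12((x+1)^2-1)$ for $x\ge0$, $0$ for $x<0$, is jumping. **Corollary.** Let $\sigma$ be jumping, and assume that for every $(x,y)\in\mathcal D$ the probability $F(y\mid x,\theta)$ is twice continuously differentiable with respect to the parameters (at $\theta$) and with respect to each of the hidden features $X^l,P^l,A^l,Z^l$ (at their values on $x$), for all $l$. Let $l\in[L]$. Then $\|A^l\|_0=\|D^l\|_0$ on every training sample; $\tilde F(y\mid x,\cdot)$ is twice continuously differentiable in $\tilde\theta_K^l$ at $\tilde\theta$ for every $(x,y)\in\mathcal D$; and $$\lim_{\varsigma\to0^+}\Big(\tfrac2{\varsigma^2}\mathbb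 E\big[\hat{\mathcal L}(\tilde F_{\tilde\theta'})-\hat{\mathcal L}(\tilde F_{\tilde\theta})\big]+\tfrac2{\varsigma^2}\mathbb E\Big[\tfrac{\tilde F(y\mid x,\tilde\theta')-\tilde F(y\mid x,\tilde\theta)}{F(y\mid x,\theta)}\Big]\Big)=\widetilde{\mathrm{AF}}_l=\mathbb E_{s\sim U(\mathcal D)}\big\|\nabla_{\tilde\theta_K^l}\ell(\tilde F_{\tilde\theta},s)\big\|_2^2$$ $$=\mathbb E\Big[\|x^l_i\|_2^2\big(\tfrac{\partial\ell}{\partial a^l_{ij}}\big)^2(d^l_{ij})^2\,\Big|\,a^l_{ij}>0\Big]\cdot\mathbb E_{s\sim U(\mathcal D)}\|D^l\|_0\ \ge\ \mathbb E\Big[\|x^l_i\|_2^2\big(\tfrac{\partial\ell}{\partial a^l_{ij}}\big)^2\,\Big|\,a^l_{ij}>0\Big]\cdot\mathbb E_{s\sim U(\mathcal D)}\|D^l\|_0 .$$ Here $\tilde\theta'$ is $\tilde\theta$ with independent noise, uniform on $[-\sqrt3\varsigma,\sqrt3\varsigma]$, added to every entry of $\tilde\theta_K^l$; the first two expectations are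 over this noise and an independent $(x,y)\sim U(\mathcal D)$, and the integrands are integrable for all small $\varsigma>0$. The conditional expectations are over independent $s\sim U(\mathcal D)$ and $(i,j)\sim U([k]\times[n])$; if the event $a^l_{ij}>0$ is null, they are read as $0$. If moreover on every training sample each token $x^l_i$ is the output of a LayerNorm without affine parameters and with zero stabiliser, i.e. $x^l_i=(u-\bar u\mathbf 1)/\sqrt{\frac1d\|u-\bar u\mathbf 1\|_2^2}$ for some $u\in\mathbb R^d$ with $u\ne\bar u\mathbf 1$, $\bar u=\frac1d\sum_a u_a$, then $$\widetilde{\mathrm{AF}}_l=d\cdot\mathbb E\Big[\big(\tfrac{\partial\ell}{\partial a^l_{ij}}\big)^2(d^l_{ij})^2\,\Big|\,a^l_{ij}>0\Big]\cdot\mathbb E_{s\sim U(\mathcal D)}\|D^l\|_0\ \ge\ d\cdot\mathbb E\Big[\big(\tfrac{\partial\ell}{\partial a^l_{ij}}\big)^2\,\Big|\,a^l_{ij}>0\Big]\cdot\mathbb E_{s\sim U(\mathcal D)}\|D^l\|_0 .$$ -/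

import Mathlib

open MeasureTheory ProbabilityTheory Filter Topology
open scoped BigOperators

noncomputable section

namespace SparseNet

/-! ### Finite uniform expectations and elementary matrix quantities

`𝔼 a ∈ s, f a` is Mathlib's expectation under the uniform distribution on the finite set `s`. -/

open Classical in
/-- Conditional expectation `E[f | p]` given the event `p`, under the uniform distribution on `s`. -/
def condExpect {α : Type*} (s : Finset α) (p : α → Prop) (f : α → ℝ) : ℝ :=
  (𝔼 a ∈ s, if p a then f a else 0) / (𝔼 a ∈ s, if p a then (1 : ℝ) else 0)

/-- The `L₀` pseudo norm: the number of non-zero entries. -/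
def l0 {k n : ℕ} (M : Fin k → Fin n → ℝ) : ℕ :=
  (Finset.univ.filter fun q : Fin k × Fin n => M q.1 q.2 ≠ 0).card

/-- Partial derivative of a scalar function of a matrix with respect to the entry `(i, j)`. -/
def entryDeriv {k n : ℕ} (g : (Fin k → Fin n → ℝ) → ℝ) (M : Fin k → Fin n → ℝ)
    (i : Fin k) (j : Fin n) : ℝ :=
  fderiv ℝ g M (Pi.single i (Pi.single j 1))

/-- Squared Euclidean norm of the gradient of a scalar function of the parameters `ι → ℝ`. -/
def gradNormSq {ι : Type*} [Fintype ι] [DecidableEq ι] (g : (ι → ℝ) → ℝ) (w : ι → ℝ) : ℝ :=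
  ∑ q, (fderiv ℝ g w (Pi.single q 1)) ^ 2

/-- Hessian matrix of second partial derivatives. -/
def hessian {ι : Type*} [Fintype ι] [DecidableEq ι] (g : (ι → ℝ) → ℝ) (w : ι → ℝ) :
    Matrix ι ι ℝ :=
  Matrix.of fun q r => fderiv ℝ (fun w' => fderiv ℝ g w' (Pi.single r 1)) w (Pi.single q 1)

/-- Law of a noise vector with independent entries uniform on `[-√3 ς, √3 ς]`
(so each entry has variance `ς²`). -/
def noiseLaw (ι : Type*) [Fintype ι] (ς : ℝ) : Measure (ι → ℝ) :=
  Measure.pi fun _ => (volume : Measure ℝ)[|Set.Icc (-(√3 * ς)) (√3 * ς)]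

/-! ### Activation functions and LayerNorm -/

/-- Jumping activation functions. Continuity at `0` is not even required. -/
structure IsJumping (σ : ℝ → ℝ) : Prop where
  eq_zero_of_nonpos : ∀ x ≤ 0, σ x = 0
  pos_of_pos : ∀ x, 0 < x → 0 < σ x
  contDiffOn_neg : ContDiffOn ℝ 2 σ (Set.Iio 0)
  contDiffOn_pos : ContDiffOn ℝ 2 σ (Set.Ioi 0)
  one_le_abs_deriv : ∀ x, 0 < x → 1 ≤ |deriv σ x|
  deriv_eq_zero : ∀ x < 0, deriv σ x = 0

/-- The activation function JSReLU. -/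
def jsrelu (x : ℝ) : ℝ := if 0 ≤ x then 1 / 2 * ((x + 1) ^ 2 - 1) else 0

/-- Mean of the entries of a vector. -/
def vecMean {d : ℕ} (u : Fin d → ℝ) : ℝ := (∑ a, u a) / d

/-- LayerNorm with affine parameters `γ, β` and stabiliser `ε`. -/
def layerNorm {d : ℕ} (γ β : Fin d → ℝ) (ε : ℝ) (u : Fin d → ℝ) : Fin d → ℝ := fun a =>
  γ a * ((u a - vecMean u) / √(1 / d * ∑ b, (u b - vecMean u) ^ 2 + ε)) + β a

/-! ### MLP blocks -/

/-- Parameters `(K, b^K, V, b^V)` of an MLP block. -/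
abbrev MLPParam (n d : ℕ) : Type :=
  (Fin n → Fin d → ℝ) × (Fin n → ℝ) × (Fin d → Fin n → ℝ) × (Fin d → ℝ)

/-- Pre-activation `P = X Kᵀ + 1 (b^K)ᵀ`. -/
def preact {k n d : ℕ} (m : MLPParam n d) (X : Fin k → Fin d → ℝ) : Fin k → Fin n → ℝ :=
  fun i j => ∑ a, X i a * m.1 j a + m.2.1 j

/-- Activation `A = σ(P)`, entrywise. -/
def act {k n : ℕ} (σ : ℝ → ℝ) (P : Fin k → Fin n → ℝ) : Fin k → Fin n → ℝ :=
  fun i j => σ (P i j)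

/-- Output `Z = A Vᵀ + 1 (b^V)ᵀ`. -/
def mlpOut {k n d : ℕ} (m : MLPParam n d) (A : Fin k → Fin n → ℝ) : Fin k → Fin d → ℝ :=
  fun i a => ∑ j, A i j * m.2.2.1 a j + m.2.2.2 a

/-- An MLP block acting on `k` tokens. -/
def mlp {k n d : ℕ} (σ : ℝ → ℝ) (m : MLPParam n d) (X : Fin k → Fin d → ℝ) :
    Fin k → Fin d → ℝ :=
  mlpOut m (act σ (preact m X))

/-- `softmax(z)_c = exp z_c / ∑ exp z_{c'}`. -/
def softmax {C : ℕ} (z : Fin C → ℝ) (c : Fin C) : ℝ :=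
  Real.exp (z c) / ∑ c', Real.exp (z c')

/-! ### Architectures (with skip connections) -/

universe u

/-- An architecture with `L` MLP blocks of width `n` acting on `k` tokens of dimension `d`, with
`C` classes. The state sets `S` are arbitrary; `T l` extracts the input of the `l`-th MLP block,
`R l` absorbs its output, `E` is the embedding and `D` the classifier. The modules
`T l`, `R l`, `D` use disjoint blocks of `qT l`, `qR l`, `qD` real parameters. -/
structure Arch (dIn k d n C L : ℕ) where
  S : Fin (L + 1) → Type u
  qT : Fin L → ℕ
  qR : Fin L → ℕ
  qD : ℕ
  E : (Fin dIn → ℝ) → S 0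
  T : ∀ l : Fin L, (Fin (qT l) → ℝ) → S l.castSucc → (Fin k → Fin d → ℝ)
  R : ∀ l : Fin L, (Fin (qR l) → ℝ) → (Fin k → Fin d → ℝ) → S l.castSucc → S l.succ
  D : (Fin qD → ℝ) → S (Fin.last L) → (Fin C → ℝ)

namespace Arch

variable {dIn k d n C L : ℕ} (N : Arch.{u} dIn k d n C L)

/-- All parameters: those of the `T l`, of the `R l`, of `D`, and of the MLP blocks. -/
abbrev Param : Type :=
  (∀ l, Fin (N.qT l) → ℝ) × (∀ l, Fin (N.qR l) → ℝ) × (Fin N.qD → ℝ) × (Fin L → MLPParam n d)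

/-- The states `S^0, …, S^L` when the output `Z^l` of layer `l` is `block l S^{l-1}`. -/
def states (ρ : ∀ l, Fin (N.qR l) → ℝ) (block : ∀ l : Fin L, N.S l.castSucc → Fin k → Fin d → ℝ)
    (x : Fin dIn → ℝ) : ∀ l : Fin (L + 1), N.S l :=
  Fin.induction (motive := N.S) (N.E x) fun l s => N.R l (ρ l) (block l s) s

/-- Class probabilities when the output `Z^l` of layer `l` is `block l S^{l-1}`. -/
def probOf (ρ : ∀ l, Fin (N.qR l) → ℝ) (δ : Fin N.qD → ℝ)
    (block : ∀ l : Fin L, N.S l.castSucc → Fin k → Fin d → ℝ) (x : Fin dIn → ℝ) (c : Fin C) : ℝ :=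
  softmax (N.D δ (N.states ρ block x (Fin.last L))) c

/-- The layer map `S^{l-1} ↦ Z^l = MLP^l(T^l(S^{l-1}))` of the network. -/
def block (σ : ℝ → ℝ) (θ : N.Param) (l : Fin L) (s : N.S l.castSucc) : Fin k → Fin d → ℝ :=
  mlp σ (θ.2.2.2 l) (N.T l (θ.1 l) s)

/-- The network: `F(c ∣ x, θ)`. -/
def prob (σ : ℝ → ℝ) (θ : N.Param) (x : Fin dIn → ℝ) (c : Fin C) : ℝ :=
  N.probOf θ.2.1 θ.2.2.1 (N.block σ θ) x c

/-- MLP input `X^l` on the input `x`. -/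
def featX (σ : ℝ → ℝ) (θ : N.Param) (l : Fin L) (x : Fin dIn → ℝ) : Fin k → Fin d → ℝ :=
  N.T l (θ.1 l) (N.states θ.2.1 (N.block σ θ) x l.castSucc)

/-- Pre-activation `P^l` on the input `x`. -/
def featP (σ : ℝ → ℝ) (θ : N.Param) (l : Fin L) (x : Fin dIn → ℝ) : Fin k → Fin n → ℝ :=
  preact (θ.2.2.2 l) (N.featX σ θ l x)

/-- Activation `A^l` on the input `x`. -/
def featA (σ : ℝ → ℝ) (θ : N.Param) (l : Fin L) (x : Fin dIn → ℝ) : Fin k → Fin n → ℝ :=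
  act σ (N.featP σ θ l x)

/-- MLP output `Z^l` on the input `x`. -/
def featZ (σ : ℝ → ℝ) (θ : N.Param) (l : Fin L) (x : Fin dIn → ℝ) : Fin k → Fin d → ℝ :=
  mlpOut (θ.2.2.2 l) (N.featA σ θ l x)

/-- Zero-assigned subderivative matrix `D^l`: the entry is `σ'(p^l_{ij})` where this derivative
exists, and `0` otherwise (`deriv` is `0` at points of non-differentiability). -/
def featD (σ : ℝ → ℝ) (θ : N.Param) (l : Fin L) (x : Fin dIn → ℝ) : Fin k → Fin n → ℝ :=
  fun i j => deriv σ (N.featP σ θ l x i j)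

/-- `F(c ∣ x, θ)` as a function of the hidden feature `Z^l`: the value computed by layer `l` is
replaced by `Z`, everything before it is kept, and later layers are recomputed. -/
def probOfZ (σ : ℝ → ℝ) (θ : N.Param) (l : Fin L) (x : Fin dIn → ℝ) (c : Fin C)
    (Z : Fin k → Fin d → ℝ) : ℝ :=
  N.probOf θ.2.1 θ.2.2.1 (Function.update (N.block σ θ) l fun _ => Z) x c

/-- `F(c ∣ x, θ)` as a function of the hidden feature `A^l`. -/
def probOfA (σ : ℝ → ℝ) (θ : N.Param) (l : Fin L) (x : Fin dIn → ℝ) (c : Fin C)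
    (A : Fin k → Fin n → ℝ) : ℝ :=
  N.probOfZ σ θ l x c (mlpOut (θ.2.2.2 l) A)

/-- `F(c ∣ x, θ)` as a function of the hidden feature `P^l`. -/
def probOfP (σ : ℝ → ℝ) (θ : N.Param) (l : Fin L) (x : Fin dIn → ℝ) (c : Fin C)
    (P : Fin k → Fin n → ℝ) : ℝ :=
  N.probOfA σ θ l x c (act σ P)

/-- `F(c ∣ x, θ)` as a function of the hidden feature `X^l`. -/
def probOfX (σ : ℝ → ℝ) (θ : N.Param) (l : Fin L) (x : Fin dIn → ℝ) (c : Fin C)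
    (X : Fin k → Fin d → ℝ) : ℝ :=
  N.probOfP σ θ l x c (preact (θ.2.2.2 l) X)

/-- On the sample `s = (x, y)`, the network is twice continuously differentiable with respect to
the parameters and to every hidden feature `X^l, P^l, A^l, Z^l`. Only the probability of the true
label, the one that enters the loss, is concerned. -/
structure TwiceDiffAt (σ : ℝ → ℝ) (θ : N.Param) (s : (Fin dIn → ℝ) × Fin C) : Prop where
  param : ContDiffAt ℝ 2 (fun θ' : N.Param => N.prob σ θ' s.1 s.2) θ
  input : ∀ l, ContDiffAt ℝ 2 (N.probOfX σ θ l s.1 s.2) (N.featX σ θ l s.1)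
  preactivation : ∀ l, ContDiffAt ℝ 2 (N.probOfP σ θ l s.1 s.2) (N.featP σ θ l s.1)
  activation : ∀ l, ContDiffAt ℝ 2 (N.probOfA σ θ l s.1 s.2) (N.featA σ θ l s.1)
  output : ∀ l, ContDiffAt ℝ 2 (N.probOfZ σ θ l s.1 s.2) (N.featZ σ θ l s.1)

/-- `∂ℓ/∂a^l_{ij}` on the sample `s`, where `ℓ = -log F(y ∣ x, θ)`. -/
def lossDerivA (σ : ℝ → ℝ) (θ : N.Param) (l : Fin L) (s : (Fin dIn → ℝ) × Fin C)
    (i : Fin k) (j : Fin n) : ℝ :=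
  entryDeriv (fun A => -Real.log (N.probOfA σ θ l s.1 s.2 A)) (N.featA σ θ l s.1) i j

/-- On the data `𝒟`, every token of the input of the `l`-th MLP block is the output of a LayerNorm
with affine parameters and stabiliser turned off, applied to a vector with non-zero variance
(so that the normalisation is defined). -/
def LayerNormed (σ : ℝ → ℝ) (θ : N.Param) (𝒟 : Finset ((Fin dIn → ℝ) × Fin C))
    (l : Fin L) : Prop :=
  ∀ s ∈ 𝒟, ∀ i : Fin k, ∃ u : Fin d → ℝ, (∃ b, u b ≠ vecMean u) ∧
    N.featX σ θ l s.1 i = layerNorm 1 0 0 u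

/-! ### Copied networks -/

/-- Parameters of the copied architecture: each `T l` and each MLP block has `k` copies. -/
structure CopiedParam where
  extr : ∀ l, Fin k → Fin (N.qT l) → ℝ
  red : ∀ l, Fin (N.qR l) → ℝ
  cls : Fin N.qD → ℝ
  mlps : Fin L → Fin k → MLPParam n d

/-- One token step of the copied architecture on `(Z̃, S̃)`: fetch the `i`-th token of
`T^{l,i}(S̃)`, feed it to the single-token block `MLP^{l,i}`, and store the result in `Z̃`. -/
def tokenStep (σ : ℝ → ℝ) (η : N.CopiedParam) (l : Fin L)
    (st : (Fin k → Fin d → ℝ) × N.S l.castSucc) (i : Fin k) :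
    (Fin k → Fin d → ℝ) × N.S l.castSucc :=
  (Function.update st.1 i
    (mlp σ (η.mlps l i) (fun _ : Fin 1 => N.T l (η.extr l i) st.2 i) 0), st.2)

/-- The layer map of the copied architecture: the `k` token steps, one after the other. -/
def copiedBlock (σ : ℝ → ℝ) (η : N.CopiedParam) (l : Fin L) (s : N.S l.castSucc) :
    Fin k → Fin d → ℝ :=
  (Fin.foldl k (N.tokenStep σ η l) (0, s)).1

/-- The copied network `F̃(c ∣ x, θ̃)`. -/
def copiedProb (σ : ℝ → ℝ) (η : N.CopiedParam) (x : Fin dIn → ℝ) (c : Fin C) : ℝ :=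
  N.probOf η.red η.cls (N.copiedBlock σ η) x c

/-- The copied parameter `θ̃` of `θ`. -/
def copyParam (θ : N.Param) : N.CopiedParam where
  extr l _ := θ.1 l
  red := θ.2.1
  cls := θ.2.2.1
  mlps l _ := θ.2.2.2 l

variable {N}

/-- The entries of all key matrices `K^{l,1}, …, K^{l,k}` of layer `l`. -/
def CopiedParam.keys (η : N.CopiedParam) (l : Fin L) : Fin k × Fin n × Fin d → ℝ :=
  fun q => (η.mlps l q.1).1 q.2.1 q.2.2

/-- Replace the key matrices of layer `l` by `w`, keeping all other parameters. -/
def CopiedParam.setKeys (η : N.CopiedParam) (l : Fin L) (w : Fin k × Fin n × Fin d → ℝ) :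
    N.CopiedParam :=
  { η with mlps := Function.update η.mlps l fun i => (fun j a => w (i, j, a), (η.mlps l i).2) }

variable (N)

/-- `F̃(y ∣ x, ·)` on the sample `s = (x, y)` as a function of the key matrices of layer `l`. -/
def keyProb (σ : ℝ → ℝ) (η : N.CopiedParam) (l : Fin L) (s : (Fin dIn → ℝ) × Fin C)
    (w : Fin k × Fin n × Fin d → ℝ) : ℝ :=
  N.copiedProb σ (η.setKeys l w) s.1 s.2

/-- Cross-entropy loss of the copied network on `s`, as a function of the keys of layer `l`. -/
def keyLoss (σ : ℝ → ℝ) (η : N.CopiedParam) (l : Fin L) (s : (Fin dIn → ℝ) × Fin C)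
    (w : Fin k × Fin n × Fin d → ℝ) : ℝ :=
  -Real.log (N.keyProb σ η l s w)

/-- Empirical loss of the copied network, as a function of the keys of layer `l`. -/
def keyEmpLoss (σ : ℝ → ℝ) (η : N.CopiedParam) (𝒟 : Finset ((Fin dIn → ℝ) × Fin C)) (l : Fin L)
    (w : Fin k × Fin n × Fin d → ℝ) : ℝ :=
  𝔼 s ∈ 𝒟, N.keyLoss σ η l s w

/-- Augmented flatness of the copied network with respect to the keys of layer `l`: the trace of
the Hessian of the empirical loss plus `E[∇² F̃(y ∣ x) / F̃(y ∣ x)]`. -/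
def keyAugFlatness (σ : ℝ → ℝ) (η : N.CopiedParam) (𝒟 : Finset ((Fin dIn → ℝ) × Fin C))
    (l : Fin L) : ℝ :=
  Matrix.trace (hessian (N.keyEmpLoss σ η 𝒟 l) (η.keys l) +
    Matrix.of fun q r => 𝔼 s ∈ 𝒟,
      hessian (N.keyProb σ η l s) (η.keys l) q r / N.copiedProb σ η s.1 s.2)

end Arch

end SparseNet

end

noncomputable section

namespace SparseNet

/-! ### Moments of the noise -/

/-! The proof joins a calculus fact about positive `C²` functions to the special structure of the
copied network.

Calculus: noise with mean zero and covariance `ς²` times the identity turns the second-order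
expansion of a `C²` function into half of `ς²` times the trace of its Hessian. The support lies in a
ball of radius `√3 * ς`, so a uniform Taylor remainder suffices and no tail has to be estimated
(`tendsto_noise_trace_hessian`). Applied to the empirical loss and to the mean of the probabilities
divided by their unperturbed values, this yields the limit. For `g > 0` the second-order part of the
Hessian of `-log g` is `-∇²g / g`. The correction in the augmented flatness cancels it exactly and
leaves the outer square of the gradient, whose trace is the squared gradient norm
(`hessian_neg_log_add`).

Structure: varying the copied keys of layer `l` amounts to replacing `P^l` by an affine function of
them (`keyProb_copyParam`). Since tokens do not share keys, the derivative in the entry `(j, a)` of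
the key matrix of token `i` is `x_{ia} ∂ℓ/∂p_{ij}`. The squared gradient is thus the sum of `‖x_i‖²
(∂ℓ/∂p_{ij})²`, without mixed terms between tokens. Next, `∂ℓ/∂p_{ij} = d_{ij} ∂ℓ/∂a_{ij}` even at a
kink of `σ` (`entryDeriv_comp_act`).

For a jumping `σ`, the conditions `a > 0`, `p > 0` and `d ≠ 0` coincide. The sum therefore runs over
active entries only, and it factors into a conditional mean times the mean number of active entries
(`condExpect_mul_expect_l0`). The lower bound is `d² ≥ 1` on active entries; LayerNorm makes
`‖x_i‖²` the constant `d`. -/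

/-- The uniform law on `[-a, a]`. -/
abbrev uniformLaw (a : ℝ) : Measure ℝ := (volume : Measure ℝ)[|Set.Icc (-a) a]

lemma isProbabilityMeasure_uniformLaw {a : ℝ} (ha : 0 < a) :
    IsProbabilityMeasure (uniformLaw a) := by
  apply cond_isProbabilityMeasure_of_finite
  · simp [Real.volume_Icc]; linarith
  · simp [Real.volume_Icc]

lemma integral_uniformLaw {a : ℝ} (ha : 0 < a) (f : ℝ → ℝ) :
    ∫ x, f x ∂(uniformLaw a) = (2 * a)⁻¹ * ∫ x in (-a)..a, f x := by
  rw [uniformLaw, ProbabilityTheory.cond, integral_smul_measure, Real.volume_Icc,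
    integral_Icc_eq_integral_Ioc, intervalIntegral.integral_of_le (by linarith)]
  rw [ENNReal.toReal_inv, ENNReal.toReal_ofReal (by linarith), smul_eq_mul]
  congr 2
  ring

lemma integral_id_uniformLaw {a : ℝ} (ha : 0 < a) : ∫ x, x ∂(uniformLaw a) = 0 := by
  rw [integral_uniformLaw ha (fun x => x), integral_id]
  ring

lemma integral_mul_self_uniformLaw {a : ℝ} (ha : 0 < a) :
    ∫ x, x * x ∂(uniformLaw a) = a ^ 2 / 3 := by
  rw [integral_uniformLaw ha (fun x => x * x)]
  simp only [← pow_two]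
  rw [integral_pow]
  field_simp
  ring

section Noise

variable {ι : Type*} [Fintype ι]

lemma isProbabilityMeasure_noiseLaw {ς : ℝ} (h : 0 < ς) :
    IsProbabilityMeasure (noiseLaw ι ς) := by
  have := isProbabilityMeasure_uniformLaw (a := √3 * ς) (by positivity)
  unfold noiseLaw
  infer_instance

/-- The norm on `ι → ℝ` is the supremum norm, so the coordinatewise bound carries over with a radius
independent of the dimension. -/
lemma ae_norm_le_noiseLaw {ς : ℝ} (h : 0 < ς) : ∀ᵐ e ∂(noiseLaw ι ς), ‖e‖ ≤ √3 * ς := by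
  have := isProbabilityMeasure_uniformLaw (a := √3 * ς) (by positivity)
  have h1 : ∀ i : ι, ∀ᵐ e ∂(noiseLaw ι ς), ‖e i‖ ≤ √3 * ς := fun i => by
    have h2 : ∀ᵐ x ∂(uniformLaw (√3 * ς)), ‖x‖ ≤ √3 * ς := by
      filter_upwards [ae_cond_mem (μ := (volume : Measure ℝ))
        (measurableSet_Icc (a := -(√3 * ς)) (b := √3 * ς))] with x hx
      exact abs_le.2 hx
    exact (measurePreserving_eval (fun _ : ι => uniformLaw (√3 * ς)) i).quasiMeasurePreserving.ae h2
  filter_upwards [ae_all_iff.2 h1] with e he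
  exact (pi_norm_le_iff_of_nonneg (by positivity)).2 he

/-- A function continuous on a ball containing the support of the noise is integrable. -/
lemma integrable_noiseLaw_of_continuousOn {ς : ℝ} (h : 0 < ς) {f : (ι → ℝ) → ℝ}
    (hf : ContinuousOn f (Metric.closedBall 0 (√3 * ς))) : Integrable f (noiseLaw ι ς) := by
  have := isProbabilityMeasure_noiseLaw (ι := ι) h
  have h1 := hf.integrableOn_compact (μ := noiseLaw ι ς) (isCompact_closedBall _ _)
  rwa [IntegrableOn, Measure.restrict_eq_self_of_ae_mem] at h1
  filter_upwards [ae_norm_le_noiseLaw (ι := ι) h] with e he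
  simpa using he

lemma integral_eval_noiseLaw {ς : ℝ} (h : 0 < ς) (i : ι) : ∫ e, e i ∂(noiseLaw ι ς) = 0 := by
  have := isProbabilityMeasure_uniformLaw (a := √3 * ς) (by positivity)
  have h1 := measurePreserving_eval (fun _ : ι => uniformLaw (√3 * ς)) i
  have h2 := integral_map (μ := noiseLaw ι ς) (f := fun x : ℝ => x) h1.measurable.aemeasurable
    aestronglyMeasurable_id
  rw [noiseLaw, h1.map_eq, integral_id_uniformLaw (by positivity)] at h2
  exact h2.symm

/-- Off the diagonal, independence factors the integral into two vanishing means. On it, the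
variance `a ^ 2 / 3` with `a = √3 * ς` is `ς ^ 2`. -/
lemma integral_eval_mul_eval_noiseLaw [DecidableEq ι] {ς : ℝ} (h : 0 < ς) (i j : ι) :
    ∫ e, e i * e j ∂(noiseLaw ι ς) = if i = j then ς ^ 2 else 0 := by
  have := isProbabilityMeasure_uniformLaw (a := √3 * ς) (by positivity)
  split_ifs with hij
  · subst hij
    have h1 := measurePreserving_eval (fun _ : ι => uniformLaw (√3 * ς)) i
    have h2 := integral_map (μ := noiseLaw ι ς) (f := fun x : ℝ => x * x) h1.measurable.aemeasurable
      (by fun_prop)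
    rw [noiseLaw, h1.map_eq, integral_mul_self_uniformLaw (by positivity)] at h2
    refine h2.symm.trans ?_
    rw [mul_pow, Real.sq_sqrt (by norm_num)]
    ring
  · have h3 : iIndepFun (fun (i : ι) (e : ι → ℝ) => e i) (noiseLaw ι ς) :=
      iIndepFun_pi (μ := fun _ : ι => uniformLaw (√3 * ς)) (X := fun _ x => x)
        (fun _ => aemeasurable_id)
    have h4 := (h3.indepFun hij).integral_fun_mul_eq_mul_integral
      (measurable_pi_apply i).aestronglyMeasurable (measurable_pi_apply j).aestronglyMeasurable
    rw [h4, integral_eval_noiseLaw h, zero_mul]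

end Noise

/-! ### Second order expansion -/

section Taylor

variable {E : Type*} [NormedAddCommGroup E] [NormedSpace ℝ E]

lemma _root_.ContDiffAt.differentiableAt_fderiv {g : E → ℝ} {w : E} (hg : ContDiffAt ℝ 2 g w) :
    DifferentiableAt ℝ (fderiv ℝ g) w :=
  (hg.fderiv_right (m := 1) (by norm_num)).differentiableAt (by norm_num)

lemma eventually_differentiableAt {g : E → ℝ} {w : E} (hg : ContDiffAt ℝ 2 g w) :
    ∀ᶠ w' in 𝓝 w, DifferentiableAt ℝ g w' := by
  filter_upwards [hg.eventually (by simp)] with w' h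
  exact h.differentiableAt (by norm_num)

/-- The derivative of the remainder is the first-order error of `fderiv ℝ g` at `w`, hence at most
`ε * r` on the ball of radius `r`; the mean value inequality supplies the second factor `r`.
Uniformity in `e` is what integration over the noise needs. -/
lemma taylor_two {g : E → ℝ} {w : E} (hg : ContDiffAt ℝ 2 g w) {ε : ℝ} (hε : 0 < ε) :
    ∀ᶠ r : ℝ in 𝓝[>] 0, ∀ e : E, ‖e‖ ≤ r →
      |g (w + e) - g w - fderiv ℝ g w e - 1 / 2 * fderiv ℝ (fderiv ℝ g) w e e| ≤ ε * r ^ 2 := by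
  have hsymm : IsSymmSndFDerivAt ℝ g w := hg.isSymmSndFDerivAt (by simp)
  have hlo := hg.differentiableAt_fderiv.hasFDerivAt.isLittleO.def hε
  have hev := hlo.and (eventually_differentiableAt hg)
  obtain ⟨δ, hδ, hball⟩ := Metric.eventually_nhds_iff.1 hev
  filter_upwards [Ioo_mem_nhdsGT hδ] with r hr e he
  set B := fderiv ℝ (fderiv ℝ g) w with hB
  let h : E → ℝ := fun e => g (w + e) - g w - fderiv ℝ g w e - 1 / 2 * B e e
  have hder : ∀ x ∈ Metric.closedBall (0 : E) r, HasFDerivWithinAt h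
      (fderiv ℝ g (w + x) - fderiv ℝ g w - B x) (Metric.closedBall (0 : E) r) x := by
    intro x hx
    have hx' : dist (w + x) w < δ := by
      simp only [dist_self_add_left, Metric.mem_closedBall, dist_zero_right] at hx ⊢
      linarith [hr.2]
    have h1 : HasFDerivAt (fun e => g (w + e)) (fderiv ℝ g (w + x)) x := by
      have := (hball hx').2.hasFDerivAt
      exact (hasFDerivAt_comp_add_left w).2 this
    have h2 : HasFDerivAt (fun e => B e e) (B x + B.flip x) x := by
      have := B.hasFDerivAt_of_bilinear (hasFDerivAt_id x) (hasFDerivAt_id x)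
      convert! this using 1
    have h3 := ((h1.sub_const (g w)).sub (fderiv ℝ g w).hasFDerivAt).sub (h2.const_mul (1 / 2))
    refine (h3.congr_fderiv ?_).hasFDerivWithinAt
    ext v
    -- Symmetry of the second derivative merges the two halves of the derivative of `1 / 2 * B e e`
    -- into `B x`.
    have : B v x = B x v := hsymm.eq v x
    simp [this]
    ring
  have hbd : ∀ x ∈ Metric.closedBall (0 : E) r,
      ‖fderiv ℝ g (w + x) - fderiv ℝ g w - B x‖ ≤ ε * r := by
    intro x hx
    have hx' : dist (w + x) w < δ := by
      simp only [dist_self_add_left, Metric.mem_closedBall, dist_zero_right] at hx ⊢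
      linarith [hr.2]
    have := (hball hx').1
    rw [add_sub_cancel_left] at this
    refine this.trans ?_
    gcongr
    simpa using hx
  have hr0 : (0 : ℝ) < r := hr.1
  have := (convex_closedBall (0 : E) r).norm_image_sub_le_of_norm_hasFDerivWithin_le hder hbd
    (Metric.mem_closedBall_self hr0.le) (by simpa using he : e ∈ Metric.closedBall (0 : E) r)
  have h0 : h 0 = 0 := by simp [h]
  rw [h0, sub_zero, sub_zero, Real.norm_eq_abs] at this
  calc |h e| ≤ ε * r * ‖e‖ := this
    _ ≤ ε * r * r := by gcongr
    _ = ε * r ^ 2 := by ring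

end Taylor

/-- For small `ς` the support of the noise lies where `g` is differentiable, hence continuous;
nothing is known about `g` farther away. -/
lemma eventually_integrable_noiseLaw {ι : Type*} [Fintype ι] {g : (ι → ℝ) → ℝ} {w : ι → ℝ} (hg : ContDiffAt ℝ 2 g w) :
    ∀ᶠ ς : ℝ in 𝓝[>] 0, Integrable (fun e => g (w + e)) (noiseLaw ι ς) := by
  obtain ⟨δ, hδ, hball⟩ := Metric.eventually_nhds_iff.1 (eventually_differentiableAt hg)
  have h3 : (0 : ℝ) < √3 := by positivity
  filter_upwards [Ioo_mem_nhdsGT (div_pos hδ h3)] with ς hς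
  refine integrable_noiseLaw_of_continuousOn hς.1 fun e he => ?_
  refine ContinuousAt.continuousWithinAt ?_
  have h4 : √3 * ς < δ := by
    have := hς.2
    rw [lt_div_iff₀ h3] at this
    linarith
  have h5 : dist (w + e) w < δ := by
    simp only [dist_self_add_left, Metric.mem_closedBall, dist_zero_right] at he ⊢
    linarith
  exact ContinuousAt.comp (f := fun e => w + e) (hball h5).continuousAt (by fun_prop)

/-! ### Hessians -/

section Hessian

variable {ι : Type*} [Fintype ι] [DecidableEq ι]

lemma hessian_apply {g : (ι → ℝ) → ℝ} {w : ι → ℝ} (hg : ContDiffAt ℝ 2 g w) (q r : ι) :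
    hessian g w q r = fderiv ℝ (fderiv ℝ g) w (Pi.single q 1) (Pi.single r 1) := by
  simp only [hessian, Matrix.of_apply]
  rw [fderiv_clm_apply hg.differentiableAt_fderiv (by fun_prop)]
  simp

lemma hessian_expect {α : Type*} (s : Finset α) {f : α → (ι → ℝ) → ℝ} {w : ι → ℝ}
    (hf : ∀ a ∈ s, ContDiffAt ℝ 2 (f a) w) (q r : ι) :
    hessian (fun w => 𝔼 a ∈ s, f a w) w q r = 𝔼 a ∈ s, hessian (f a) w q r := by
  simp only [hessian, Matrix.of_apply, Finset.expect_eq_sum_div_card]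
  -- The first derivatives must agree on a neighbourhood, not just at `w`, because they are
  -- differentiated once more.
  have h1 : (fun w' => fderiv ℝ (fun w => (∑ a ∈ s, f a w) / (s.card : ℝ)) w' (Pi.single r 1))
      =ᶠ[𝓝 w] fun w' => (s.card : ℝ)⁻¹ * ∑ a ∈ s, fderiv ℝ (f a) w' (Pi.single r 1) := by
    have h2 : ∀ᶠ w' in 𝓝 w, ∀ a ∈ s, DifferentiableAt ℝ (f a) w' :=
      (Filter.eventually_all_finset s).2 fun a ha => eventually_differentiableAt (hf a ha)
    filter_upwards [h2] with w' hw'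
    have h3 : HasFDerivAt (fun w => (∑ a ∈ s, f a w) / (s.card : ℝ))
        ((s.card : ℝ)⁻¹ • ∑ a ∈ s, fderiv ℝ (f a) w') w' := by
      have := (HasFDerivAt.fun_sum fun a ha => (hw' a ha).hasFDerivAt).const_mul (s.card : ℝ)⁻¹
      simpa only [div_eq_inv_mul] using this
    rw [h3.fderiv]
    simp
  rw [h1.fderiv_eq]
  have h4 : HasFDerivAt
      (fun w' => (s.card : ℝ)⁻¹ * ∑ a ∈ s, fderiv ℝ (f a) w' (Pi.single r 1))
      ((s.card : ℝ)⁻¹ • ∑ a ∈ s, fderiv ℝ (fun w' => fderiv ℝ (f a) w' (Pi.single r 1)) w) w := by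
    refine (HasFDerivAt.fun_sum fun a ha => ?_).const_mul _
    exact ((hf a ha).differentiableAt_fderiv.clm_apply (differentiableAt_const _)).hasFDerivAt
  rw [h4.fderiv]
  simp [div_eq_inv_mul]

lemma hessian_div_const {g : (ι → ℝ) → ℝ} {w : ι → ℝ} (hg : ContDiffAt ℝ 2 g w) (c : ℝ)
    (q r : ι) : hessian (fun w => g w / c) w q r = hessian g w q r / c := by
  simp only [hessian, Matrix.of_apply]
  have h1 : (fun w' => fderiv ℝ (fun w => g w / c) w' (Pi.single r 1))
      =ᶠ[𝓝 w] fun w' => c⁻¹ * fderiv ℝ g w' (Pi.single r 1) := by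
    filter_upwards [eventually_differentiableAt hg] with w' hw'
    simp only [div_eq_inv_mul]
    rw [fderiv_const_mul hw']
    simp
  rw [h1.fderiv_eq, fderiv_const_mul
    (hg.differentiableAt_fderiv.clm_apply (differentiableAt_const _))]
  simp [div_eq_inv_mul]

lemma fderiv_neg_log {E : Type*} [NormedAddCommGroup E] [NormedSpace ℝ E] {g : E → ℝ} {w : E}
    (hg : DifferentiableAt ℝ g w) (h0 : g w ≠ 0) (v : E) :
    fderiv ℝ (fun w => -Real.log (g w)) w v = -(fderiv ℝ g w v / g w) := by
  rw [(hg.hasFDerivAt.log h0).fun_neg.fderiv]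
  simp [div_eq_inv_mul]

/-- The Hessian of `-log g` is the outer square of its gradient minus `∇²g / g`. -/
lemma hessian_neg_log_add {g : (ι → ℝ) → ℝ} {w : ι → ℝ} (hg : ContDiffAt ℝ 2 g w)
    (h0 : g w ≠ 0) (q r : ι) :
    hessian (fun w => -Real.log (g w)) w q r + hessian g w q r / g w =
      fderiv ℝ (fun w => -Real.log (g w)) w (Pi.single q 1) *
        fderiv ℝ (fun w => -Real.log (g w)) w (Pi.single r 1) := by
  have hd : DifferentiableAt ℝ g w := hg.differentiableAt (by norm_num)
  simp only [hessian, Matrix.of_apply]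
  have h1 : (fun w' => fderiv ℝ (fun w => -Real.log (g w)) w' (Pi.single r 1))
      =ᶠ[𝓝 w] fun w' => -(fderiv ℝ g w' (Pi.single r 1) * (g w')⁻¹) := by
    filter_upwards [eventually_differentiableAt hg, hg.continuousAt.eventually_ne h0]
      with w' hw' hw0
    rw [fderiv_neg_log hw' hw0, div_eq_mul_inv]
  have h2 := (hg.differentiableAt_fderiv.clm_apply
    (differentiableAt_const (Pi.single r (1 : ℝ)))).hasFDerivAt
  have h3 : HasFDerivAt (fun w' => (g w')⁻¹) (-(g w ^ 2)⁻¹ • fderiv ℝ g w) w :=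
    (hasDerivAt_inv h0).comp_hasFDerivAt w hd.hasFDerivAt
  rw [h1.fderiv_eq, (h2.fun_mul h3).fun_neg.fderiv, fderiv_neg_log hd h0, fderiv_neg_log hd h0]
  simp
  field_simp
  ring

/-! ### Flatness as the effect of noise -/

lemma clm_apply_eq_sum (A : (ι → ℝ) →L[ℝ] ℝ) (e : ι → ℝ) :
    A e = ∑ q, e q * A (Pi.single q 1) := by
  conv_lhs => rw [pi_eq_sum_univ' e]
  simp [map_sum, Pi.single]

lemma integral_clm_noiseLaw {ς : ℝ} (h : 0 < ς) (A : (ι → ℝ) →L[ℝ] ℝ) :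
    ∫ e, A e ∂(noiseLaw ι ς) = 0 := by
  rw [integral_congr_ae (.of_forall (clm_apply_eq_sum A))]
  rw [integral_finsetSum _ fun q _ => integrable_noiseLaw_of_continuousOn h (by fun_prop)]
  simp [integral_mul_const, integral_eval_noiseLaw h]

/-- Expanded in coordinates, only the diagonal terms survive the covariance, which produces the
trace. -/
lemma integral_bilin_noiseLaw {ς : ℝ} (h : 0 < ς) (B : (ι → ℝ) →L[ℝ] (ι → ℝ) →L[ℝ] ℝ) :
    ∫ e, B e e ∂(noiseLaw ι ς) = ς ^ 2 * ∑ q, B (Pi.single q 1) (Pi.single q 1) := by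
  have h1 : ∀ e, B e e = ∑ q, ∑ r, e q * e r * B (Pi.single q 1) (Pi.single r 1) := by
    intro e
    have := clm_apply_eq_sum (B.flip e) e
    rw [ContinuousLinearMap.flip_apply] at this
    rw [this]
    refine Finset.sum_congr rfl fun q _ => ?_
    rw [ContinuousLinearMap.flip_apply, clm_apply_eq_sum (B _) e, Finset.mul_sum]
    exact Finset.sum_congr rfl fun r _ => by ring
  rw [integral_congr_ae (.of_forall h1), integral_finsetSum _ fun q _ => integrable_noiseLaw_of_continuousOn h (by fun_prop)]
  rw [Finset.mul_sum]
  refine Finset.sum_congr rfl fun q _ => ?_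
  rw [integral_finsetSum _ fun q _ => integrable_noiseLaw_of_continuousOn h (by fun_prop)]
  simp [integral_mul_const, integral_eval_mul_eval_noiseLaw h]

/-- The mean effect of small independent noise on a `C²` function is half of the trace of its
Hessian times the variance of the noise. -/
lemma tendsto_noise_trace_hessian {g : (ι → ℝ) → ℝ} {w : ι → ℝ} (hg : ContDiffAt ℝ 2 g w) :
    Tendsto (fun ς : ℝ => 2 / ς ^ 2 * ∫ e, (g (w + e) - g w) ∂(noiseLaw ι ς)) (𝓝[>] 0)
      (𝓝 (Matrix.trace (hessian g w))) := by
  have h3 : (0 : ℝ) < √3 := by positivity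
  rw [Metric.tendsto_nhds]
  intro ε hε
  have hmap : Tendsto (fun ς : ℝ => √3 * ς) (𝓝[>] 0) (𝓝[>] 0) := by
    refine tendsto_nhdsWithin_iff.2 ⟨?_, ?_⟩
    · have : Tendsto (fun ς : ℝ => √3 * ς) (𝓝 0) (𝓝 (√3 * 0)) := by
        exact Continuous.tendsto (by fun_prop) 0
      rw [mul_zero] at this
      exact this.mono_left nhdsWithin_le_nhds
    · filter_upwards [self_mem_nhdsWithin] with ς hς
      exact mul_pos h3 hς
  -- The remainder is at most `ε / 12 * (√3 * ς) ^ 2 = ε * ς ^ 2 / 4`, which the factor `2 / ς ^ 2`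
  -- turns into `ε / 2`.
  filter_upwards [hmap.eventually (taylor_two hg (ε := ε / 12) (by positivity)),
    eventually_integrable_noiseLaw hg, self_mem_nhdsWithin] with ς hT hI hς
  have hς : 0 < ς := hς
  have := isProbabilityMeasure_noiseLaw (ι := ι) hς
  set A := fderiv ℝ g w
  set B := fderiv ℝ (fderiv ℝ g) w
  have hA : Integrable (fun e => A e) (noiseLaw ι ς) :=
    integrable_noiseLaw_of_continuousOn hς (by fun_prop)
  have hB : Integrable (fun e => 1 / 2 * B e e) (noiseLaw ι ς) :=
    integrable_noiseLaw_of_continuousOn hς (by fun_prop)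
  have hD : Integrable (fun e => g (w + e) - g w) (noiseLaw ι ς) := hI.sub (integrable_const _)
  have htr : Matrix.trace (hessian g w) = ∑ q, B (Pi.single q 1) (Pi.single q 1) := by
    simp [Matrix.trace, hessian_apply hg, B]
  have hsplit : ∫ e, (g (w + e) - g w - A e - 1 / 2 * B e e) ∂(noiseLaw ι ς) =
      ∫ e, (g (w + e) - g w) ∂(noiseLaw ι ς) - 1 / 2 * (ς ^ 2 * Matrix.trace (hessian g w)) := by
    rw [integral_sub (hD.sub' hA) hB, integral_sub hD hA, integral_clm_noiseLaw hς,
      integral_const_mul, integral_bilin_noiseLaw hς, htr, sub_zero]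
  have hbd : |∫ e, (g (w + e) - g w - A e - 1 / 2 * B e e) ∂(noiseLaw ι ς)| ≤
      ε / 12 * (√3 * ς) ^ 2 := by
    have := norm_integral_le_of_norm_le_const (μ := noiseLaw ι ς)
      (f := fun e => g (w + e) - g w - A e - 1 / 2 * B e e) (C := ε / 12 * (√3 * ς) ^ 2)
      (by filter_upwards [ae_norm_le_noiseLaw (ι := ι) hς] with e he using hT e he)
    simpa using this
  rw [hsplit, mul_pow, Real.sq_sqrt (by norm_num)] at hbd
  rw [Real.dist_eq]
  have hς2 : (0 : ℝ) < ς ^ 2 := by positivity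
  have heq : 2 / ς ^ 2 * ∫ e, (g (w + e) - g w) ∂(noiseLaw ι ς) - Matrix.trace (hessian g w) =
      2 / ς ^ 2 * (∫ e, (g (w + e) - g w) ∂(noiseLaw ι ς)
        - 1 / 2 * (ς ^ 2 * Matrix.trace (hessian g w))) := by
    field_simp
  rw [heq, abs_mul, abs_of_pos (by positivity : 0 < 2 / ς ^ 2)]
  calc _ ≤ 2 / ς ^ 2 * (ε / 12 * (3 * ς ^ 2)) := by gcongr
    _ = ε / 2 := by field_simp; norm_num
    _ < ε := by linarith

end Hessian

/-! ### Jumping activation functions -/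

lemma isJumping_jsrelu : IsJumping jsrelu := by
  have hpos : ∀ x : ℝ, 0 < x → jsrelu =ᶠ[𝓝 x] fun x => 1 / 2 * ((x + 1) ^ 2 - 1) := by
    intro x hx
    filter_upwards [lt_mem_nhds hx] with y hy
    rw [jsrelu, if_pos hy.le]
  have hneg : ∀ x : ℝ, x < 0 → jsrelu =ᶠ[𝓝 x] fun _ => 0 := by
    intro x hx
    filter_upwards [gt_mem_nhds hx] with y hy
    rw [jsrelu, if_neg hy.not_ge]
  refine ⟨fun x hx => ?_, fun x hx => ?_, ?_, ?_, fun x hx => ?_, fun x hx => ?_⟩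
  · rcases hx.lt_or_eq with h | rfl
    · exact (hneg x h).eq_of_nhds
    · simp [jsrelu]
  · rw [(hpos x hx).eq_of_nhds]
    nlinarith
  · exact fun x hx => (contDiffAt_const.congr_of_eventuallyEq (hneg x hx)).contDiffWithinAt
  · intro x hx
    refine (ContDiffAt.congr_of_eventuallyEq ?_ (hpos x hx)).contDiffWithinAt
    fun_prop
  · rw [(hpos x hx).deriv_eq]
    have : HasDerivAt (fun x : ℝ => 1 / 2 * ((x + 1) ^ 2 - 1)) (x + 1) x := by
      have := ((((hasDerivAt_id x).add_const 1).pow 2).sub_const 1).const_mul (1 / 2)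
      convert! this using 1
      simp
    rw [this.deriv, abs_of_pos (by linarith)]
    linarith
  · rw [(hneg x hx).deriv_eq]
    simp

namespace IsJumping

variable {σ : ℝ → ℝ} (hσ : IsJumping σ)
include hσ

lemma pos_iff {x : ℝ} : 0 < σ x ↔ 0 < x :=
  ⟨fun h => not_le.1 fun hx => h.ne' (hσ.eq_zero_of_nonpos x hx), hσ.pos_of_pos x⟩

lemma ne_zero_iff {x : ℝ} : σ x ≠ 0 ↔ 0 < x :=
  ⟨fun h => not_le.1 fun hx => h (hσ.eq_zero_of_nonpos x hx), fun h => (hσ.pos_of_pos x h).ne'⟩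

lemma differentiableAt {x : ℝ} (hx : 0 < x) : DifferentiableAt ℝ σ x :=
  (hσ.contDiffOn_pos.contDiffAt (Ioi_mem_nhds hx)).differentiableAt (by norm_num)

lemma continuousOn_deriv : ContinuousOn (deriv σ) (Set.Ioi 0) :=
  hσ.contDiffOn_pos.continuousOn_deriv_of_isOpen isOpen_Ioi (by norm_num)

/-- A negative derivative on the positive half-line would make `σ` negative far out. -/
lemma exists_deriv_pos : ∃ x, 0 < x ∧ 0 < deriv σ x := by
  have h1 := hσ.pos_of_pos 1 one_pos
  -- Slope `-1` over an interval of length `σ 1` would bring the value down to exactly `0`.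
  -- Positivity at the right end thus forces a mean slope above `-1`, and `|σ'| ≥ 1` then excludes a
  -- negative derivative at `c`.
  obtain ⟨c, hc, hcd⟩ := exists_deriv_eq_slope σ (a := 1) (b := 1 + σ 1) (by linarith)
    (fun x hx => (hσ.differentiableAt (by linarith [hx.1])).continuousAt.continuousWithinAt)
    (fun x hx => (hσ.differentiableAt (by linarith [hx.1])).differentiableWithinAt)
  refine ⟨c, by linarith [hc.1], ?_⟩
  have h2 := hσ.pos_of_pos (1 + σ 1) (by linarith)
  have h3 := hσ.one_le_abs_deriv c (by linarith [hc.1])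
  have h4 : -1 < deriv σ c := by
    rw [hcd, add_sub_cancel_left, lt_div_iff₀ h1]
    linarith
  rcases le_abs.1 h3 with h | h <;> linarith

/-- The continuous function `σ'` avoids `0` on the positive half-line, so it keeps the sign that it
has at the point of `exists_deriv_pos`. -/
lemma one_le_deriv {x : ℝ} (hx : 0 < x) : 1 ≤ deriv σ x := by
  obtain ⟨c, hc, hcd⟩ := hσ.exists_deriv_pos
  by_contra hlt
  have hneg : deriv σ x ≤ -1 := by
    rcases le_abs.1 (hσ.one_le_abs_deriv x hx) with h | h
    · exact absurd h hlt
    · linarith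
  obtain ⟨z, hz, hz0⟩ := isPreconnected_Ioi.intermediate_value (Set.mem_Ioi.2 hx)
    (Set.mem_Ioi.2 hc) hσ.continuousOn_deriv (⟨by linarith, hcd.le⟩ : (0 : ℝ) ∈ Set.Icc _ _)
  have := hσ.one_le_abs_deriv z hz
  rw [hz0] at this
  norm_num at this

/-- If the derivative exists, it equals the left derivative of a function vanishing on the left;
otherwise `deriv` takes its default value `0`. -/
lemma deriv_zero : deriv σ 0 = 0 := by
  by_cases hd : DifferentiableAt ℝ σ 0
  · have h := hd.hasDerivAt
    have hl : HasDerivWithinAt σ 0 (Set.Iic 0) 0 :=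
      (hasDerivWithinAt_const (0 : ℝ) (Set.Iic 0) (0 : ℝ)).congr
        (fun x hx => hσ.eq_zero_of_nonpos x hx) (hσ.eq_zero_of_nonpos 0 le_rfl)
    exact (uniqueDiffWithinAt_Iic 0).eq_deriv _ h.hasDerivWithinAt hl
  · exact deriv_zero_of_not_differentiableAt hd

lemma deriv_ne_zero_iff {x : ℝ} : deriv σ x ≠ 0 ↔ 0 < x := by
  refine ⟨fun h => ?_, fun h => ?_⟩
  · rcases lt_trichotomy x 0 with hx | rfl | hx
    · exact absurd (hσ.deriv_eq_zero x hx) h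
    · exact absurd hσ.deriv_zero h
    · exact hx
  · have := hσ.one_le_deriv h
    intro h0
    linarith

lemma l0_act {k n : ℕ} (P : Fin k → Fin n → ℝ) :
    l0 (act σ P) = l0 (fun i j => deriv σ (P i j)) := by
  simp only [l0, act, hσ.ne_zero_iff, hσ.deriv_ne_zero_iff]

end IsJumping

/-- Since `σ` acts entrywise, a coordinate line is mapped into a coordinate line. This allows a
chain rule one entry at a time where `act σ` need not be differentiable as a whole. -/
lemma act_add_single {k n : ℕ} (σ : ℝ → ℝ) (P : Fin k → Fin n → ℝ) (i : Fin k) (j : Fin n)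
    (t : ℝ) : act σ (P + t • (Pi.single i (Pi.single j 1) : Fin k → Fin n → ℝ)) =
      act σ P + (σ (P i j + t) - σ (P i j)) •
        (Pi.single i (Pi.single j 1) : Fin k → Fin n → ℝ) := by
  ext i' j'
  simp only [act, Pi.add_apply, Pi.smul_apply, smul_eq_mul]
  by_cases hi : i' = i
  · subst hi
    by_cases hj : j' = j
    · subst hj; simp
    · simp [hj]
  · simp [hi]

/-- The derivative in an entry of `P` of a function of `σ(P)`. Neither the activation nor the outer
function need be differentiable separately at an inactive entry: there the composition is constant
in the negative direction. -/
lemma entryDeriv_comp_act {k n : ℕ} {σ : ℝ → ℝ} (hσ : IsJumping σ)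
    {f : (Fin k → Fin n → ℝ) → ℝ} {P : Fin k → Fin n → ℝ}
    (hf : DifferentiableAt ℝ f (act σ P)) (hfP : DifferentiableAt ℝ (fun P => f (act σ P)) P)
    (i : Fin k) (j : Fin n) :
    entryDeriv (fun P => f (act σ P)) P i j =
      entryDeriv f (act σ P) i j * deriv σ (P i j) := by
  set v : Fin k → Fin n → ℝ := Pi.single i (Pi.single j 1)
  have hline : HasDerivAt (fun t : ℝ => f (act σ (P + t • v)))
      (entryDeriv (fun P => f (act σ P)) P i j) 0 := by
    have h1 : HasDerivAt (fun t : ℝ => P + t • v) v 0 := by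
      simpa using ((hasDerivAt_id (0 : ℝ)).smul_const v).const_add P
    have h2 : HasFDerivAt (fun P => f (act σ P)) (fderiv ℝ (fun P => f (act σ P)) P)
        (P + (0 : ℝ) • v) := by
      simpa using hfP.hasFDerivAt
    exact HasFDerivAt.comp_hasDerivAt (l := fun P => f (act σ P)) (0 : ℝ) h2 h1
  rcases le_or_gt (P i j) 0 with hp | hp
  · have hd : deriv σ (P i j) = 0 := by
      by_contra h
      exact (hσ.deriv_ne_zero_iff.1 h).not_ge hp
    rw [hd, mul_zero]
    have hc : HasDerivWithinAt (fun t : ℝ => f (act σ (P + t • v))) 0 (Set.Iic 0) 0 := by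
      have hconst : ∀ t ∈ Set.Iic (0 : ℝ), f (act σ (P + t • v)) = f (act σ P) := by
        intro t ht
        rw [act_add_single, hσ.eq_zero_of_nonpos _ hp,
          hσ.eq_zero_of_nonpos _ (by linarith [Set.mem_Iic.1 ht])]
        simp
      exact (hasDerivWithinAt_const (0 : ℝ) (Set.Iic 0) (f (act σ P))).congr hconst
        (hconst 0 (by simp))
    exact (uniqueDiffWithinAt_Iic 0).eq_deriv _ hline.hasDerivWithinAt hc
  -- Only the active entry moves along this line, so kinks at the other entries do no harm.
  · have h1 : HasDerivAt (fun t : ℝ => act σ (P + t • v)) (deriv σ (P i j) • v) 0 := by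
      simp_rw [v, act_add_single]
      refine HasDerivAt.const_add _ (HasDerivAt.smul_const ?_ _)
      have h2 : HasDerivAt σ (deriv σ (P i j)) (P i j + 0) := by
        simpa using (hσ.differentiableAt hp).hasDerivAt
      simpa using (h2.comp_const_add (P i j) 0).sub_const (σ (P i j))
    have h2 : HasFDerivAt f (fderiv ℝ f (act σ P)) (act σ (P + (0 : ℝ) • v)) := by
      simpa using hf.hasFDerivAt
    have h3 := h2.comp_hasDerivAt (0 : ℝ) h1
    rw [hline.unique h3, map_smul, smul_eq_mul, mul_comm]
    rfl

/-! ### The copied network as a function of the keys of one layer -/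

/-- Pre-activations when token `i` uses the key matrix `w i`. -/
def keyPreact {k n d : ℕ} (X : Fin k → Fin d → ℝ) (b : Fin n → ℝ)
    (w : Fin k × Fin n × Fin d → ℝ) : Fin k → Fin n → ℝ :=
  fun i j => ∑ a, X i a * w (i, j, a) + b j

/-- This is what copying achieves: one key entry moves one entry of `P`. A shared key would move a
whole column and mix the tokens in the gradient. -/
lemma keyPreact_add_single {k n d : ℕ} (X : Fin k → Fin d → ℝ) (b : Fin n → ℝ)
    (w : Fin k × Fin n × Fin d → ℝ) (i : Fin k) (j : Fin n) (a : Fin d) (t : ℝ) :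
    keyPreact X b (w + t • Pi.single (i, j, a) 1) =
      keyPreact X b w +
        t • X i a • (Pi.single i (Pi.single j 1) : Fin k → Fin n → ℝ) := by
  ext i' j'
  simp only [keyPreact, Pi.add_apply, Pi.smul_apply, smul_eq_mul, mul_add, Finset.sum_add_distrib]
  by_cases hi : i' = i
  · subst hi
    by_cases hj : j' = j
    · subst hj
      simp [Pi.single_apply]
      ring
    · simp [hj]
  · simp [hi]

lemma contDiff_keyPreact {k n d : ℕ} (X : Fin k → Fin d → ℝ) (b : Fin n → ℝ) {m : WithTop ℕ∞} :
    ContDiff ℝ m (keyPreact X b) := by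
  refine contDiff_pi.2 fun i => contDiff_pi.2 fun j => ?_
  unfold keyPreact
  fun_prop

lemma fderiv_comp_keyPreact {k n d : ℕ} (X : Fin k → Fin d → ℝ) (b : Fin n → ℝ)
    (w : Fin k × Fin n × Fin d → ℝ) {g : (Fin k → Fin n → ℝ) → ℝ}
    (hg : DifferentiableAt ℝ g (keyPreact X b w)) (i : Fin k) (j : Fin n) (a : Fin d) :
    fderiv ℝ (fun w => g (keyPreact X b w)) w (Pi.single (i, j, a) 1) =
      X i a * entryDeriv g (keyPreact X b w) i j := by
  have hK : DifferentiableAt ℝ (keyPreact X b) w :=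
    (contDiff_keyPreact X b (m := 1)).differentiable (by norm_num) w
  have h1 : HasDerivAt (fun t : ℝ => keyPreact X b (w + t • Pi.single (i, j, a) 1))
      (X i a • Pi.single i (Pi.single j 1)) 0 := by
    simp_rw [keyPreact_add_single]
    simpa using ((hasDerivAt_id (0 : ℝ)).smul_const
      (X i a • (Pi.single i (Pi.single j 1) : Fin k → Fin n → ℝ))).const_add (keyPreact X b w)
  have h2 := hK.hasFDerivAt.hasLineDerivAt (Pi.single (i, j, a) 1)
  have h3 : fderiv ℝ (keyPreact X b) w (Pi.single (i, j, a) 1) =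
      X i a • Pi.single i (Pi.single j 1) := HasDerivAt.unique h2 h1
  rw [show (fun w => g (keyPreact X b w)) = g ∘ keyPreact X b from rfl, fderiv_comp w hg hK,
    ContinuousLinearMap.comp_apply, h3, map_smul, smul_eq_mul]
  rfl

lemma gradNormSq_comp_keyPreact {k n d : ℕ} (X : Fin k → Fin d → ℝ) (b : Fin n → ℝ)
    (w : Fin k × Fin n × Fin d → ℝ) {g : (Fin k → Fin n → ℝ) → ℝ}
    (hg : DifferentiableAt ℝ g (keyPreact X b w)) :
    gradNormSq (fun w => g (keyPreact X b w)) w =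
      ∑ q : Fin k × Fin n, (∑ a, X q.1 a ^ 2) * entryDeriv g (keyPreact X b w) q.1 q.2 ^ 2 := by
  simp only [gradNormSq, Fintype.sum_prod_type, fderiv_comp_keyPreact X b w hg, mul_pow,
    Finset.sum_mul]

lemma softmax_pos {C : ℕ} (z : Fin C → ℝ) (c : Fin C) : 0 < softmax z c :=
  div_pos (Real.exp_pos _)
    (Finset.sum_pos (fun _ _ => Real.exp_pos _) ⟨c, Finset.mem_univ _⟩)

/-- Each step reads only the component that never changes and writes only its own entry, so the
sequential token steps amount to a simultaneous assignment. -/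
lemma foldl_update {ι β γ : Type*} [DecidableEq ι] (f : ι → γ → β) (l : List ι) (z : ι → β)
    (s : γ) :
    l.foldl (fun (st : (ι → β) × γ) i => (Function.update st.1 i (f i st.2), st.2)) (z, s) =
      (fun i => if i ∈ l then f i s else z i, s) := by
  induction l generalizing z with
  | nil => simp
  | cons a l ih =>
    rw [List.foldl_cons, ih]
    refine Prod.ext (funext fun i => ?_) rfl
    by_cases hl : i ∈ l
    · simp [hl]
    · by_cases ha : i = a
      · subst ha; simp [hl]
      · simp [hl, ha]

namespace Arch

variable {dIn k d n C L : ℕ} (N : Arch dIn k d n C L) (σ : ℝ → ℝ)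

lemma probOf_pos (ρ : ∀ l, Fin (N.qR l) → ℝ) (δ : Fin N.qD → ℝ)
    (block : ∀ l : Fin L, N.S l.castSucc → Fin k → Fin d → ℝ) (x : Fin dIn → ℝ) (c : Fin C) :
    0 < N.probOf ρ δ block x c :=
  softmax_pos _ _

lemma states_succ (ρ : ∀ l, Fin (N.qR l) → ℝ)
    (block : ∀ l : Fin L, N.S l.castSucc → Fin k → Fin d → ℝ) (x : Fin dIn → ℝ) (l : Fin L) :
    N.states ρ block x l.succ =
      N.R l (ρ l) (block l (N.states ρ block x l.castSucc)) (N.states ρ block x l.castSucc) :=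
  Fin.induction_succ _ _ _

/-- The states up to layer `m` depend only on the values of the layer maps before `m`. -/
lemma states_congr {ρ : ∀ l, Fin (N.qR l) → ℝ}
    {b₁ b₂ : ∀ l : Fin L, N.S l.castSucc → Fin k → Fin d → ℝ} {x : Fin dIn → ℝ}
    (m : Fin (L + 1)) (h : ∀ l : Fin L, l.castSucc < m →
      b₁ l (N.states ρ b₁ x l.castSucc) = b₂ l (N.states ρ b₁ x l.castSucc)) :
    N.states ρ b₁ x m = N.states ρ b₂ x m := by
  induction m using Fin.induction with
  | zero => rfl
  | succ m ih =>
    have h1 := ih fun l hl => h l (hl.trans (Fin.castSucc_lt_succ))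
    rw [states_succ, states_succ, h m Fin.castSucc_lt_succ, h1]

/-- The map of layer `l` is first used in forming the state after it, so overriding that map leaves
the input of the layer intact. -/
lemma states_update (ρ : ∀ l, Fin (N.qR l) → ℝ)
    (b : ∀ l : Fin L, N.S l.castSucc → Fin k → Fin d → ℝ) (x : Fin dIn → ℝ) (l : Fin L)
    (f : N.S l.castSucc → Fin k → Fin d → ℝ) :
    N.states ρ (Function.update b l f) x l.castSucc = N.states ρ b x l.castSucc := by
  refine N.states_congr _ fun j hj => ?_
  rw [Function.update_of_ne]
  rintro rfl
  exact lt_irrefl _ hj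

lemma copiedBlock_apply (η : N.CopiedParam) (l : Fin L) (s : N.S l.castSucc) (i : Fin k) :
    N.copiedBlock σ η l s i =
      mlp σ (η.mlps l i) (fun _ : Fin 1 => N.T l (η.extr l i) s i) 0 := by
  have := foldl_update (fun i (s : N.S l.castSucc) =>
    mlp σ (η.mlps l i) (fun _ : Fin 1 => N.T l (η.extr l i) s i) 0) (List.finRange k) 0 s
  rw [copiedBlock, Fin.foldl_eq_finRange_foldl]
  unfold tokenStep
  rw [this]
  simp

lemma keyPreact_keys (θ : N.Param) (l : Fin L) (x : Fin dIn → ℝ) :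
    keyPreact (N.featX σ θ l x) (θ.2.2.2 l).2.1 ((N.copyParam θ).keys l) = N.featP σ θ l x := rfl

/-- As a function of the keys of layer `l`, the copied network is the original one with the
pre-activations of layer `l` replaced. -/
lemma keyProb_copyParam (θ : N.Param) (l : Fin L) (s : (Fin dIn → ℝ) × Fin C)
    (w : Fin k × Fin n × Fin d → ℝ) :
    N.keyProb σ (N.copyParam θ) l s w =
      N.probOfP σ θ l s.1 s.2 (keyPreact (N.featX σ θ l s.1) (θ.2.2.2 l).2.1 w) := by
  unfold keyProb copiedProb probOfP probOfA probOfZ probOf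
  congr 2
  refine (N.states_congr _ fun j _ => ?_).symm
  funext i
  rw [copiedBlock_apply]
  -- At layer `l` the copies read the same state as the original network, by `states_update`. At
  -- every other layer all copies carry the original parameters.
  by_cases hj : j = l
  · subst hj
    rw [states_update]
    simp only [Function.update_self, CopiedParam.setKeys]
    rfl
  · simp only [Function.update_of_ne hj, CopiedParam.setKeys]
    rfl

lemma copiedProb_copyParam (θ : N.Param) (x : Fin dIn → ℝ) (c : Fin C) :
    N.copiedProb σ (N.copyParam θ) x c = N.prob σ θ x c := by
  unfold copiedProb prob probOf
  congr 2
  refine N.states_congr _ fun j _ => ?_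
  funext i
  rw [copiedBlock_apply]
  rfl

lemma setKeys_keys (η : N.CopiedParam) (l : Fin L) : η.setKeys l (η.keys l) = η := by
  simp [CopiedParam.setKeys, CopiedParam.keys]

lemma keyProb_keys (η : N.CopiedParam) (l : Fin L) (s : (Fin dIn → ℝ) × Fin C) :
    N.keyProb σ η l s (η.keys l) = N.copiedProb σ η s.1 s.2 := by
  rw [keyProb, setKeys_keys]

end Arch

/-! ### Conditional expectations -/

lemma condExpect_congr_mul {α : Type*} {s : Finset α} {p : α → Prop} {f g : α → ℝ} (c : ℝ)
    (h : ∀ a ∈ s, p a → f a = c * g a) : condExpect s p f = c * condExpect s p g := by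
  classical
  unfold condExpect
  rw [← mul_div_assoc, Finset.mul_expect]
  congr 1
  refine Finset.expect_congr rfl fun a ha => ?_
  split_ifs with hp
  · exact h a ha hp
  · simp

lemma condExpect_mono {α : Type*} {s : Finset α} {p : α → Prop} {f g : α → ℝ}
    (h : ∀ a ∈ s, p a → f a ≤ g a) : condExpect s p f ≤ condExpect s p g := by
  classical
  unfold condExpect
  refine div_le_div_of_nonneg_right (Finset.expect_le_expect fun a ha => ?_)
    (Finset.expect_nonneg fun a _ => ?_)
  · split_ifs with hp
    · exact h a ha hp
    · exact le_rfl
  · split_ifs <;> norm_num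

open Classical in
/-- A conditional expectation over samples and entries, given that the entry is active, times the
mean number of active entries is the mean of the sum over the active entries. -/
lemma condExpect_mul_expect_l0 {α : Type*} {k n : ℕ} (s : Finset α)
    (M : α → Fin k → Fin n → ℝ) (p : α × Fin k × Fin n → Prop)
    (hp : ∀ t, p t ↔ M t.1 t.2.1 t.2.2 ≠ 0) (f : α × Fin k × Fin n → ℝ) :
    condExpect (s ×ˢ (Finset.univ : Finset (Fin k × Fin n))) p f * (𝔼 a ∈ s, (l0 (M a) : ℝ)) =
      𝔼 a ∈ s, ∑ q : Fin k × Fin n, if p (a, q) then f (a, q) else 0 := by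
  have hl0 : ∀ a, (l0 (M a) : ℝ) = ∑ q : Fin k × Fin n, if p (a, q) then (1 : ℝ) else 0 := by
    intro a
    simp only [l0, Finset.card_filter, hp, Nat.cast_sum, Nat.cast_ite, Nat.cast_one, Nat.cast_zero]
  simp_rw [hl0]
  unfold condExpect
  simp only [Finset.expect_eq_sum_div_card, Finset.sum_product, Finset.card_product, Nat.cast_mul]
  set S := ∑ a ∈ s, ∑ q : Fin k × Fin n, if p (a, q) then (1 : ℝ) else 0 with hS
  set T := ∑ a ∈ s, ∑ q : Fin k × Fin n, if p (a, q) then f (a, q) else 0 with hT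
  -- The cardinalities cancel in `T / S * S` unless the event is null. In that case division by zero
  -- makes the conditional expectation `0`, and `T` vanishes as well.
  by_cases h0 : S = 0
  · have hnn : ∀ a ∈ s, (0 : ℝ) ≤ ∑ q : Fin k × Fin n, if p (a, q) then (1 : ℝ) else 0 :=
      fun a _ => Finset.sum_nonneg fun q _ => by split_ifs <;> norm_num
    have hT0 : T = 0 := by
      refine Finset.sum_eq_zero fun a ha => Finset.sum_eq_zero fun q _ => ?_
      have h1 := (Finset.sum_eq_zero_iff_of_nonneg hnn).1 h0 a ha
      have h2 := (Finset.sum_eq_zero_iff_of_nonneg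
        (fun q _ => by split_ifs <;> norm_num)).1 h1 q (Finset.mem_univ q)
      rw [if_neg]
      intro hpq
      simp [hpq] at h2
    simp [h0, hT0]
  · have hs : (s.card : ℝ) ≠ 0 := by
      rintro h
      have : s = ∅ := by simpa using h
      exact h0 (by simp [hS, this])
    have hu : ((Finset.univ : Finset (Fin k × Fin n)).card : ℝ) ≠ 0 := by
      rintro h
      have : (Finset.univ : Finset (Fin k × Fin n)) = ∅ := by
        exact Finset.card_eq_zero.1 (by exact_mod_cast h)
      exact h0 (by simp [hS, this])
    field_simp

/-! ### LayerNorm -/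

/-- The output of a LayerNorm without affine parameters and stabiliser has squared norm `d`. -/
lemma sum_sq_layerNorm {d : ℕ} {u : Fin d → ℝ} (hu : ∃ b, u b ≠ vecMean u) :
    ∑ a, layerNorm 1 0 0 u a ^ 2 = d := by
  obtain ⟨b, hb⟩ := hu
  have hV : 0 < ∑ b, (u b - vecMean u) ^ 2 :=
    Finset.sum_pos' (fun _ _ => sq_nonneg _)
      ⟨b, Finset.mem_univ _, by have := sub_ne_zero.2 hb; positivity⟩
  have hd : (0 : ℝ) < d := Nat.cast_pos.2 b.pos
  simp only [layerNorm, Pi.one_apply, one_mul, Pi.zero_apply, add_zero, div_pow]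
  rw [Real.sq_sqrt (by positivity), ← Finset.sum_div]
  field_simp

/-! ### Augmented flatness of the copied network -/

namespace Arch

variable {dIn k d n C L : ℕ} (N : Arch dIn k d n C L) {σ : ℝ → ℝ} {θ : N.Param}

/-- The keys enter only through the affine map `keyPreact`, so smoothness in `P^l` is enough,
whatever `σ` does at `0`. -/
lemma contDiffAt_keyProb {s : (Fin dIn → ℝ) × Fin C} (h : N.TwiceDiffAt σ θ s) (l : Fin L) :
    ContDiffAt ℝ 2 (N.keyProb σ (N.copyParam θ) l s) ((N.copyParam θ).keys l) := by
  rw [funext (N.keyProb_copyParam σ θ l s)]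
  have h1 := h.preactivation l
  rw [← keyPreact_keys] at h1
  exact h1.comp ((N.copyParam θ).keys l) (contDiff_keyPreact _ _).contDiffAt

lemma keyProb_pos (η : N.CopiedParam) (l : Fin L) (s : (Fin dIn → ℝ) × Fin C)
    (w : Fin k × Fin n × Fin d → ℝ) : 0 < N.keyProb σ η l s w :=
  N.probOf_pos _ _ _ _ _

lemma contDiffAt_keyLoss {s : (Fin dIn → ℝ) × Fin C} (h : N.TwiceDiffAt σ θ s) (l : Fin L) :
    ContDiffAt ℝ 2 (N.keyLoss σ (N.copyParam θ) l s) ((N.copyParam θ).keys l) :=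
  ((N.contDiffAt_keyProb h l).log (N.keyProb_pos _ _ _ _).ne').neg

lemma _root_.ContDiffAt.expect {E α : Type*} [NormedAddCommGroup E] [NormedSpace ℝ E]
    {s : Finset α} {f : α → E → ℝ} {w : E} {m : WithTop ℕ∞}
    (h : ∀ a ∈ s, ContDiffAt ℝ m (f a) w) : ContDiffAt ℝ m (fun w => 𝔼 a ∈ s, f a w) w := by
  simp only [Finset.expect_eq_sum_div_card]
  exact (ContDiffAt.sum h).div_const _

variable {𝒟 : Finset ((Fin dIn → ℝ) × Fin C)}

lemma contDiffAt_keyEmpLoss (hdiff : ∀ s ∈ 𝒟, N.TwiceDiffAt σ θ s) (l : Fin L) :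
    ContDiffAt ℝ 2 (N.keyEmpLoss σ (N.copyParam θ) 𝒟 l) ((N.copyParam θ).keys l) :=
  ContDiffAt.expect fun s hs => N.contDiffAt_keyLoss (hdiff s hs) l

/-- On each sample, the diagonal of the identity `hessian_neg_log_add` gives the squares of the
partial derivatives; trace and sample mean commute. -/
lemma keyAugFlatness_eq_expect_gradNormSq (hdiff : ∀ s ∈ 𝒟, N.TwiceDiffAt σ θ s) (l : Fin L) :
    N.keyAugFlatness σ (N.copyParam θ) 𝒟 l =
      𝔼 s ∈ 𝒟, gradNormSq (N.keyLoss σ (N.copyParam θ) l s) ((N.copyParam θ).keys l) := by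
  unfold keyAugFlatness gradNormSq
  rw [Finset.expect_sum_comm]
  refine Finset.sum_congr rfl fun q _ => ?_
  rw [Matrix.diag_apply, Matrix.add_apply, Matrix.of_apply]
  unfold keyEmpLoss
  rw [hessian_expect 𝒟 fun s hs => N.contDiffAt_keyLoss (hdiff s hs) l,
    ← Finset.expect_add_distrib]
  refine Finset.expect_congr rfl fun s hs => ?_
  rw [← keyProb_keys N σ _ l, pow_two]
  exact hessian_neg_log_add (N.contDiffAt_keyProb (hdiff s hs) l) (N.keyProb_pos _ _ _ _).ne' q q

/-- The denominator stays at the unperturbed parameter, so the second summand is again the noise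
effect on a `C²` function, with Hessian the mean of `∇²F̃ / F̃`. -/
lemma tendsto_noise_keyAugFlatness (hdiff : ∀ s ∈ 𝒟, N.TwiceDiffAt σ θ s) (l : Fin L) :
    Tendsto (fun ς : ℝ =>
        2 / ς ^ 2 * (∫ e, (N.keyEmpLoss σ (N.copyParam θ) 𝒟 l ((N.copyParam θ).keys l + e)
            - N.keyEmpLoss σ (N.copyParam θ) 𝒟 l ((N.copyParam θ).keys l))
          ∂(noiseLaw (Fin k × Fin n × Fin d) ς))
        + 2 / ς ^ 2 * (∫ e, (𝔼 s ∈ 𝒟, (N.keyProb σ (N.copyParam θ) l s ((N.copyParam θ).keys l + e)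
            - N.copiedProb σ (N.copyParam θ) s.1 s.2) / N.prob σ θ s.1 s.2)
          ∂(noiseLaw (Fin k × Fin n × Fin d) ς)))
      (𝓝[>] 0) (𝓝 (N.keyAugFlatness σ (N.copyParam θ) 𝒟 l)) := by
  have hdiv : ∀ s ∈ 𝒟, ContDiffAt ℝ 2
      (fun w => N.keyProb σ (N.copyParam θ) l s w / N.prob σ θ s.1 s.2)
      ((N.copyParam θ).keys l) :=
    fun s hs => (N.contDiffAt_keyProb (hdiff s hs) l).div_const _
  have h1 := tendsto_noise_trace_hessian (N.contDiffAt_keyEmpLoss hdiff l)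
  have h2 := tendsto_noise_trace_hessian (ContDiffAt.expect hdiv)
  convert h1.add h2 using 2
  · simp_rw [← Finset.expect_sub_distrib, ← sub_div, keyProb_keys]
  · rw [keyAugFlatness, Matrix.trace_add]
    congr 2
    ext q r
    rw [hessian_expect _ hdiv, Matrix.of_apply]
    refine Finset.expect_congr rfl fun s hs => ?_
    rw [hessian_div_const (N.contDiffAt_keyProb (hdiff s hs) l), copiedProb_copyParam]

lemma gradNormSq_keyLoss (hσ : IsJumping σ) {s : (Fin dIn → ℝ) × Fin C}
    (h : N.TwiceDiffAt σ θ s) (l : Fin L) :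
    gradNormSq (N.keyLoss σ (N.copyParam θ) l s) ((N.copyParam θ).keys l) =
      ∑ q : Fin k × Fin n, (∑ a, N.featX σ θ l s.1 q.1 a ^ 2) *
        N.lossDerivA σ θ l s q.1 q.2 ^ 2 * N.featD σ θ l s.1 q.1 q.2 ^ 2 := by
  have hfun : N.keyLoss σ (N.copyParam θ) l s = fun w =>
      -Real.log (N.probOfP σ θ l s.1 s.2 (keyPreact (N.featX σ θ l s.1) (θ.2.2.2 l).2.1 w)) := by
    funext w
    rw [keyLoss, keyProb_copyParam]
  have hP : DifferentiableAt ℝ (fun P => -Real.log (N.probOfP σ θ l s.1 s.2 P))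
      (N.featP σ θ l s.1) :=
    (((h.preactivation l).differentiableAt (by norm_num)).log (N.probOf_pos _ _ _ _ _).ne').fun_neg
  have hA : DifferentiableAt ℝ (fun A => -Real.log (N.probOfA σ θ l s.1 s.2 A))
      (N.featA σ θ l s.1) :=
    (((h.activation l).differentiableAt (by norm_num)).log (N.probOf_pos _ _ _ _ _).ne').fun_neg
  rw [hfun, gradNormSq_comp_keyPreact (N.featX σ θ l s.1) (θ.2.2.2 l).2.1 ((N.copyParam θ).keys l)
    (g := fun P => -Real.log (N.probOfP σ θ l s.1 s.2 P)) hP, keyPreact_keys]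
  refine Finset.sum_congr rfl fun q _ => ?_
  have := entryDeriv_comp_act hσ hA hP q.1 q.2
  unfold probOfP
  rw [this, mul_pow, ← mul_assoc]
  rfl

lemma featA_pos_iff (hσ : IsJumping σ) (l : Fin L) (x : Fin dIn → ℝ) (i : Fin k) (j : Fin n) :
    0 < N.featA σ θ l x i j ↔ N.featD σ θ l x i j ≠ 0 :=
  hσ.pos_iff.trans hσ.deriv_ne_zero_iff.symm

lemma one_le_featD_sq (hσ : IsJumping σ) {l : Fin L} {x : Fin dIn → ℝ} {i : Fin k} {j : Fin n}
    (h : 0 < N.featA σ θ l x i j) : 1 ≤ N.featD σ θ l x i j ^ 2 :=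
  one_le_pow₀ (hσ.one_le_deriv (hσ.pos_iff.1 h))

/-- Inactive entries carry the factor `d_{ij} = 0`, so restricting the squared gradient to active
entries loses nothing. -/
lemma keyAugFlatness_eq_condExpect (hσ : IsJumping σ) (hdiff : ∀ s ∈ 𝒟, N.TwiceDiffAt σ θ s)
    (l : Fin L) :
    N.keyAugFlatness σ (N.copyParam θ) 𝒟 l =
      condExpect (𝒟 ×ˢ (Finset.univ : Finset (Fin k × Fin n)))
        (fun t => 0 < N.featA σ θ l t.1.1 t.2.1 t.2.2)
        (fun t => (∑ a, (N.featX σ θ l t.1.1 t.2.1 a) ^ 2) *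
          (N.lossDerivA σ θ l t.1 t.2.1 t.2.2) ^ 2 * (N.featD σ θ l t.1.1 t.2.1 t.2.2) ^ 2) *
      (𝔼 s ∈ 𝒟, (l0 (N.featD σ θ l s.1) : ℝ)) := by
  rw [keyAugFlatness_eq_expect_gradNormSq N hdiff, condExpect_mul_expect_l0 𝒟
    (fun s => N.featD σ θ l s.1) _ (fun t => N.featA_pos_iff hσ l t.1.1 t.2.1 t.2.2)]
  refine Finset.expect_congr rfl fun s hs => ?_
  rw [N.gradNormSq_keyLoss hσ (hdiff s hs)]
  refine Finset.sum_congr rfl fun q _ => ?_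
  split_ifs with h
  · rfl
  · rw [featA_pos_iff N hσ, not_not] at h
    rw [h]
    ring

end Arch

end SparseNet

end

theorem corollaryC1 {dIn k d n C L : ℕ} (N : SparseNet.Arch dIn k d n C L)
    (σ : ℝ → ℝ) (hσ : SparseNet.IsJumping σ) (θ : N.Param)
    (𝒟 : Finset ((Fin dIn → ℝ) × Fin C)) (h𝒟 : 𝒟.Nonempty)
    (hdiff : ∀ s ∈ 𝒟, N.TwiceDiffAt σ θ s) (l : Fin L) :
    -- JSReLU is a jumping activation function
    SparseNet.IsJumping SparseNet.jsrelu ∧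
    -- activation sparsity equals derivative sparsity
    (∀ s ∈ 𝒟, SparseNet.l0 (N.featA σ θ l s.1) = SparseNet.l0 (N.featD σ θ l s.1)) ∧
    -- the copied network is `C²` in its keys, so that the augmented flatness is meaningful
    (∀ s ∈ 𝒟, ContDiffAt ℝ 2 (N.keyProb σ (N.copyParam θ) l s) ((N.copyParam θ).keys l)) ∧
    -- augmented flatness as the limit of the effect of small noise on the keys
    (∀ᶠ ς : ℝ in 𝓝[>] 0,
      Integrable (fun e => N.keyEmpLoss σ (N.copyParam θ) 𝒟 l ((N.copyParam θ).keys l + e))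
        (SparseNet.noiseLaw (Fin k × Fin n × Fin d) ς) ∧
      ∀ s ∈ 𝒟, Integrable (fun e => N.keyProb σ (N.copyParam θ) l s ((N.copyParam θ).keys l + e))
        (SparseNet.noiseLaw (Fin k × Fin n × Fin d) ς)) ∧
    Tendsto (fun ς : ℝ =>
        2 / ς ^ 2 * (∫ e, (N.keyEmpLoss σ (N.copyParam θ) 𝒟 l ((N.copyParam θ).keys l + e)
            - N.keyEmpLoss σ (N.copyParam θ) 𝒟 l ((N.copyParam θ).keys l))
          ∂(SparseNet.noiseLaw (Fin k × Fin n × Fin d) ς))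
        + 2 / ς ^ 2 * (∫ e, (𝔼 s ∈ 𝒟, (N.keyProb σ (N.copyParam θ) l s ((N.copyParam θ).keys l + e)
            - N.copiedProb σ (N.copyParam θ) s.1 s.2) / N.prob σ θ s.1 s.2)
          ∂(SparseNet.noiseLaw (Fin k × Fin n × Fin d) ς)))
      (𝓝[>] 0) (𝓝 (N.keyAugFlatness σ (N.copyParam θ) 𝒟 l)) ∧
    -- augmented flatness as an expected squared gradient norm
    N.keyAugFlatness σ (N.copyParam θ) 𝒟 l =
      (𝔼 s ∈ 𝒟, SparseNet.gradNormSq (N.keyLoss σ (N.copyParam θ) l s) ((N.copyParam θ).keys l)) ∧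
    -- augmented flatness and sparsity
    N.keyAugFlatness σ (N.copyParam θ) 𝒟 l =
      SparseNet.condExpect (𝒟 ×ˢ (Finset.univ : Finset (Fin k × Fin n)))
        (fun t => 0 < N.featA σ θ l t.1.1 t.2.1 t.2.2)
        (fun t => (∑ a, (N.featX σ θ l t.1.1 t.2.1 a) ^ 2) *
          (N.lossDerivA σ θ l t.1 t.2.1 t.2.2) ^ 2 * (N.featD σ θ l t.1.1 t.2.1 t.2.2) ^ 2) *
      (𝔼 s ∈ 𝒟, (SparseNet.l0 (N.featD σ θ l s.1) : ℝ)) ∧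
    SparseNet.condExpect (𝒟 ×ˢ (Finset.univ : Finset (Fin k × Fin n)))
        (fun t => 0 < N.featA σ θ l t.1.1 t.2.1 t.2.2)
        (fun t => (∑ a, (N.featX σ θ l t.1.1 t.2.1 a) ^ 2) *
          (N.lossDerivA σ θ l t.1 t.2.1 t.2.2) ^ 2) *
      (𝔼 s ∈ 𝒟, (SparseNet.l0 (N.featD σ θ l s.1) : ℝ)) ≤
      N.keyAugFlatness σ (N.copyParam θ) 𝒟 l ∧
    -- the case of LayerNorm-ed MLP inputs
    (N.LayerNormed σ θ 𝒟 l →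
      N.keyAugFlatness σ (N.copyParam θ) 𝒟 l =
        d * SparseNet.condExpect (𝒟 ×ˢ (Finset.univ : Finset (Fin k × Fin n)))
          (fun t => 0 < N.featA σ θ l t.1.1 t.2.1 t.2.2)
          (fun t => (N.lossDerivA σ θ l t.1 t.2.1 t.2.2) ^ 2 *
            (N.featD σ θ l t.1.1 t.2.1 t.2.2) ^ 2) *
        (𝔼 s ∈ 𝒟, (SparseNet.l0 (N.featD σ θ l s.1) : ℝ)) ∧
      d * SparseNet.condExpect (𝒟 ×ˢ (Finset.univ : Finset (Fin k × Fin n)))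
          (fun t => 0 < N.featA σ θ l t.1.1 t.2.1 t.2.2)
          (fun t => (N.lossDerivA σ θ l t.1 t.2.1 t.2.2) ^ 2) *
        (𝔼 s ∈ 𝒟, (SparseNet.l0 (N.featD σ θ l s.1) : ℝ)) ≤
        N.keyAugFlatness σ (N.copyParam θ) 𝒟 l) := by
  have hmono : SparseNet.condExpect (𝒟 ×ˢ (Finset.univ : Finset (Fin k × Fin n)))
      (fun t => 0 < N.featA σ θ l t.1.1 t.2.1 t.2.2)
      (fun t => (∑ a, (N.featX σ θ l t.1.1 t.2.1 a) ^ 2) *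
        (N.lossDerivA σ θ l t.1 t.2.1 t.2.2) ^ 2) *
      (𝔼 s ∈ 𝒟, (SparseNet.l0 (N.featD σ θ l s.1) : ℝ)) ≤
      N.keyAugFlatness σ (N.copyParam θ) 𝒟 l := by
    rw [N.keyAugFlatness_eq_condExpect hσ hdiff l]
    refine mul_le_mul_of_nonneg_right (SparseNet.condExpect_mono fun t _ ht => ?_)
      (Finset.expect_nonneg fun _ _ => Nat.cast_nonneg _)
    -- The event `a > 0` is exactly where `d² ≥ 1`, so dropping this factor can only lower the
    -- conditional mean.
    exact le_mul_of_one_le_right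
      (mul_nonneg (Finset.sum_nonneg fun _ _ => sq_nonneg _) (sq_nonneg _))
      (N.one_le_featD_sq hσ ht)
  refine ⟨SparseNet.isJumping_jsrelu, fun s _ => hσ.l0_act _,
    fun s hs => N.contDiffAt_keyProb (hdiff s hs) l, ?_, N.tendsto_noise_keyAugFlatness hdiff l,
    N.keyAugFlatness_eq_expect_gradNormSq hdiff l, N.keyAugFlatness_eq_condExpect hσ hdiff l,
    hmono, fun hLN => ?_⟩
  · exact (SparseNet.eventually_integrable_noiseLaw (N.contDiffAt_keyEmpLoss hdiff l)).and
      ((Filter.eventually_all_finset 𝒟).2 fun s hs =>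
        SparseNet.eventually_integrable_noiseLaw (N.contDiffAt_keyProb (hdiff s hs) l))
  · have hnorm : ∀ t ∈ 𝒟 ×ˢ (Finset.univ : Finset (Fin k × Fin n)),
        ∑ a, (N.featX σ θ l t.1.1 t.2.1 a) ^ 2 = d := by
      intro t ht
      obtain ⟨u, hu, hx⟩ := hLN t.1 (Finset.mem_product.1 ht).1 t.2.1
      rw [hx, SparseNet.sum_sq_layerNorm hu]
    constructor
    · rw [N.keyAugFlatness_eq_condExpect hσ hdiff l,
        SparseNet.condExpect_congr_mul (d : ℝ) fun t ht _ => by rw [hnorm t ht, mul_assoc]]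
    · rwa [SparseNet.condExpect_congr_mul (d : ℝ) fun t ht _ => by rw [hnorm t ht]] at hmono
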